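/- Let $n\ge 1$, let $\Omega\subset\mathbb{R}^n$ be a bounded domain (non-empty, open, connected), and let $1<p<r<p^*$, where $p^*=\frac{np}{n-p}$ if $p<n$ and $p^*=+\infty$ otherwise. Let \[ \lambda_1(p)=\inf_{u\in W^{1,p}_0(\Omega)\setminus\{0\}}\frac{\int_\Omega|\nabla u|^p}{\int_\Omega|u|^p} \] be the first Dirichlet eigenvalue of the $p$-Laplacian, and for $1<q<p$ set \[ \hat\Lambda(p,q,r)=\lambda_1(p)^{\frac{r-q}{r-p}}\,(r-p)\left(\frac{(p-q)^{p-q}}{(r-q)^{r-q}}\right)^{\frac1{r-p}}. \] For $1<q<p$ and $\Lambda\in\mathbb{R}$ consider the problem \[ -\Delta_p u=\Lambda\,u^{q-1}+u^{r-1}\ \text{ in }\Omega,\qquad u=0\ \text{ on }\partial\Omega. \] A positive weak solution is a function $u\in W^{1,p}_0(\Omega)$ with $u>0$ a.e. in $\Omega$, with $\Lambda u^{q-1}+u^{r-1}\in L^1_{\mathrm{loc}}(\Omega)$, and with \[ \int_\Omega|\nabla u|^{p-2}\nabla u\cdot\nabla\varphi=\int_\Omega(\Lambda u^{q-1}+u^{r-1})\varphi\qquad\text{for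 all }\varphi\in C_c^\infty(\Omega). \] Let $\Lambda_{q,r}\in[0,\infty]$ be the supremum of all $\Lambda>0$ for which the problem has a positive weak solution (with $\sup\emptyset=0$). Then, for every $q\in(1,p)$, the problem has no positive weak solution for $\Lambda>\hat\Lambda(p,q,r)$, and consequently $\Lambda_{q,r}\le\hat\Lambda(p,q,r)$. Moreover, for fixed $p$ and $r$, \[ \limsup_{q\to p^-}\Lambda_{q,r}\le\lambda_1(p). \] -/

import Mathlib

open MeasureTheory Filter Topology
open scoped ENNReal ContDiff

noncomputable section

namespace ConcaveConvex

/-- Test functions: smooth functions on `ℝⁿ` with compact support contained in `Ω`. -/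
structure IsTestFunction {n : ℕ} (Ω : Set (EuclideanSpace ℝ (Fin n)))
    (φ : EuclideanSpace ℝ (Fin n) → ℝ) : Prop where
  contDiff : ContDiff ℝ ∞ φ
  hasCompactSupport : HasCompactSupport φ
  tsupport_subset : tsupport φ ⊆ Ω

/-- `G` is the weak (distributional) gradient of `u` in `Ω`. -/
structure HasWeakGradient {n : ℕ} (Ω : Set (EuclideanSpace ℝ (Fin n)))
    (u : EuclideanSpace ℝ (Fin n) → ℝ)
    (G : EuclideanSpace ℝ (Fin n) → EuclideanSpace ℝ (Fin n)) : Prop where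
  locallyIntegrableOn : LocallyIntegrableOn u Ω
  locallyIntegrableOn_grad : LocallyIntegrableOn G Ω
  integral_eq : ∀ φ, IsTestFunction Ω φ →
    ∫ x in Ω, u x • gradient φ x = - ∫ x in Ω, φ x • G x

/-- `u ∈ W₀^{1,p}(Ω)` with weak gradient `G`: both are in `L^p(Ω)`, and `u` is a limit of test
functions in the norm of `W^{1,p}(Ω)`. Only the restrictions of `u` and `G` to `Ω` matter, up to
null sets. -/
structure MemSobolevZero {n : ℕ} (Ω : Set (EuclideanSpace ℝ (Fin n))) (p : ℝ)
    (u : EuclideanSpace ℝ (Fin n) → ℝ)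
    (G : EuclideanSpace ℝ (Fin n) → EuclideanSpace ℝ (Fin n)) : Prop where
  hasWeakGradient : HasWeakGradient Ω u G
  memLp : MemLp u (ENNReal.ofReal p) (volume.restrict Ω)
  memLp_grad : MemLp G (ENNReal.ofReal p) (volume.restrict Ω)
  exists_approx : ∃ φ : ℕ → EuclideanSpace ℝ (Fin n) → ℝ,
    (∀ k, IsTestFunction Ω (φ k)) ∧
    Tendsto (fun k => eLpNorm (fun x => φ k x - u x) (ENNReal.ofReal p) (volume.restrict Ω))
      atTop (𝓝 0) ∧
    Tendsto (fun k => eLpNorm (fun x => gradient (φ k) x - G x) (ENNReal.ofReal p)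
      (volume.restrict Ω)) atTop (𝓝 0)

/-- The first Dirichlet eigenvalue `λ₁(p)` of the `p`-Laplacian in `Ω`: the infimum of the Rayleigh
quotient over `W₀^{1,p}(Ω) \ {0}`. -/
def firstEigenvalue {n : ℕ} (Ω : Set (EuclideanSpace ℝ (Fin n))) (p : ℝ) : ℝ :=
  sInf {ρ : ℝ | ∃ u G, MemSobolevZero Ω p u G ∧ ¬ (u =ᵐ[volume.restrict Ω] 0) ∧
    ρ = (∫ x in Ω, ‖G x‖ ^ p) / ∫ x in Ω, |u x| ^ p}

/-- `u` is a positive weak solution of `-Δ_p u = Λ u^{q-1} + u^{r-1}` in `Ω`, `u = 0` on `∂Ω`. The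
boundary condition is `u ∈ W₀^{1,p}(Ω)`; the right-hand side is required to be locally
integrable, so that it can be tested. -/
def IsPositiveWeakSolution {n : ℕ} (Ω : Set (EuclideanSpace ℝ (Fin n))) (p q r Λ : ℝ)
    (u : EuclideanSpace ℝ (Fin n) → ℝ) : Prop :=
  (∀ᵐ x ∂(volume.restrict Ω), 0 < u x) ∧
  LocallyIntegrableOn (fun x => Λ * u x ^ (q - 1) + u x ^ (r - 1)) Ω ∧
  ∃ G, MemSobolevZero Ω p u G ∧ ∀ φ, IsTestFunction Ω φ →
    ∫ x in Ω, ‖G x‖ ^ (p - 2) * inner ℝ (G x) (gradient φ x) =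
      ∫ x in Ω, (Λ * u x ^ (q - 1) + u x ^ (r - 1)) * φ x

/-- The existence threshold `Λ_{q,r}`: the supremum, in `[0, ∞]`, of the `Λ > 0` for which there is
a positive weak solution. -/
def existenceThreshold {n : ℕ} (Ω : Set (EuclideanSpace ℝ (Fin n))) (p q r : ℝ) : ℝ≥0∞ :=
  sSup {L : ℝ≥0∞ | ∃ Λ : ℝ, 0 < Λ ∧ (∃ u, IsPositiveWeakSolution Ω p q r Λ u) ∧
    L = ENNReal.ofReal Λ}

/-- The explicit bound `Λ̂(p,q,r)`. -/
def upperThreshold {n : ℕ} (Ω : Set (EuclideanSpace ℝ (Fin n))) (p q r : ℝ) : ℝ :=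
  firstEigenvalue Ω p ^ ((r - q) / (r - p)) * (r - p) *
    ((p - q) ^ (p - q) / (r - q) ^ (r - q)) ^ (1 / (r - p))

end ConcaveConvex

end

/-!
If `u > 0` and `-Δ_p u ≥ μ u ^ (p - 1)`, testing with `|φ| ^ p / (u + δ) ^ (p - 1)`, bounding the
gradient term by Young's inequality (Picone) and letting `δ → 0` gives `μ ∫ |φ| ^ p ≤ ∫ |∇φ| ^ p`,
so `μ ≤ λ₁(p)`. On the other hand, the weighted AM-GM inequality shows that
`μ t ^ (p - 1) ≤ Λ t ^ (q - 1) + t ^ (r - 1)` for all `t > 0` as soon as `Λ` is at least the value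
of the formula for `Λ̂` with `μ` in place of `λ₁(p)`. If `Λ > Λ̂`, this holds for some `μ > λ₁(p)`,
which a positive solution would contradict.
-/

noncomputable section

namespace ConcaveConvex

open scoped Convolution

section Mollification

variable {E F : Type*} [NormedAddCommGroup E] [NormedSpace ℝ E] [FiniteDimensional ℝ E]
  [MeasurableSpace E] [BorelSpace E] [NormedAddCommGroup F] [NormedSpace ℝ F]
  {f : E → F} {μ : Measure E} [μ.IsAddHaarMeasure]

theorem tsupport_normed_convolution_subset (ρ : ContDiffBump (0 : E)) :
    tsupport (ρ.normed μ ⋆[ContinuousLinearMap.lsmul ℝ ℝ, μ] f) ⊆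
      Metric.cthickening ρ.rOut (tsupport f) := by
  refine closure_minimal ((support_convolution_subset _).trans ?_) Metric.isClosed_cthickening
  rw [ρ.support_normed_eq, ball_add_zero]
  exact (Metric.thickening_subset_of_subset _ (subset_tsupport f)).trans
    (Metric.thickening_subset_cthickening _ _)

theorem fderiv_normed_convolution (ρ : ContDiffBump (0 : E)) (hf : ContDiff ℝ 1 f)
    (hfc : HasCompactSupport f) :
    fderiv ℝ (ρ.normed μ ⋆[ContinuousLinearMap.lsmul ℝ ℝ, μ] f) =
      ρ.normed μ ⋆[ContinuousLinearMap.lsmul ℝ ℝ, μ] fderiv ℝ f := by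
  have hL : ContinuousLinearMap.precompR E (ContinuousLinearMap.lsmul ℝ ℝ) =
      (ContinuousLinearMap.lsmul ℝ ℝ : ℝ →L[ℝ] (E →L[ℝ] F) →L[ℝ] E →L[ℝ] F) := by
    ext; simp
  funext x
  have hρ := ρ.integrable_normed (μ := μ)
  rw [(hfc.hasFDerivAt_convolution_right _ hρ.locallyIntegrable hf x).fderiv, hL]

theorem tendstoUniformly_normed_convolution [CompleteSpace F] {ι : Type*} {l : Filter ι}
    {ρ : ι → ContDiffBump (0 : E)} (hρ : Tendsto (fun i => (ρ i).rOut) l (𝓝 0)) (hf : Continuous f)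
    (hfc : HasCompactSupport f) :
    TendstoUniformly (fun i => (ρ i).normed μ ⋆[ContinuousLinearMap.lsmul ℝ ℝ, μ] f) f l := by
  rw [Metric.tendstoUniformly_iff]
  intro ε hε
  obtain ⟨δ, hδ, hfδ⟩ := Metric.uniformContinuous_iff.1 (hfc.uniformContinuous_of_continuous hf)
    (ε / 2) (half_pos hε)
  filter_upwards [hρ.eventually_lt_const hδ] with i hi x
  rw [dist_comm]
  exact ((ρ i).dist_normed_convolution_le hf.aestronglyMeasurable
    fun y hy => (hfδ (hy.out.trans hi)).le).trans_lt (half_lt_self hε)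

end Mollification

theorem exists_contDiff_tendstoUniformly {E F : Type*} [NormedAddCommGroup E]
    [NormedSpace ℝ E] [FiniteDimensional ℝ E] [NormedAddCommGroup F] [NormedSpace ℝ F]
    [CompleteSpace F] {f : E → F} {U : Set E} (hU : IsOpen U) (hf : ContDiff ℝ 1 f)
    (hfc : HasCompactSupport f) (hfU : tsupport f ⊆ U) :
    ∃ K, IsCompact K ∧ K ⊆ U ∧ ∃ g : ℕ → E → F, (∀ k, ContDiff ℝ ∞ (g k)) ∧
      (∀ k, tsupport (g k) ⊆ K) ∧ TendstoUniformly g f atTop ∧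
      TendstoUniformly (fun k => fderiv ℝ (g k)) (fderiv ℝ f) atTop := by
  borelize E
  obtain ⟨R, hR, hRU⟩ := hfc.isCompact.exists_cthickening_subset_open hU hfU
  have hpos : ∀ k : ℕ, 0 < R / (k + 1) := fun k => by positivity
  let ρ (k : ℕ) : ContDiffBump (0 : E) :=
    ⟨R / (k + 1) / 2, R / (k + 1), half_pos (hpos k), half_lt_self (hpos k)⟩
  have hρ : Tendsto (fun k => (ρ k).rOut) atTop (𝓝 0) := by
    simpa [ρ, div_eq_mul_inv] using tendsto_one_div_add_atTop_nhds_zero_nat.const_mul R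
  have hρR : ∀ k, (ρ k).rOut ≤ R := fun k => div_le_self hR.le (by simp)
  refine ⟨_, hfc.isCompact.cthickening, hRU,
    fun k => (ρ k).normed Measure.addHaar ⋆[ContinuousLinearMap.lsmul ℝ ℝ, Measure.addHaar] f,
    fun k => (ρ k).hasCompactSupport_normed.contDiff_convolution_left _ (ρ k).contDiff_normed
      hf.continuous.locallyIntegrable,
    fun k => (tsupport_normed_convolution_subset _).trans (Metric.cthickening_mono (hρR k) _),
    tendstoUniformly_normed_convolution hρ hf.continuous hfc, ?_⟩
  simp only [fderiv_normed_convolution _ hf hfc]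
  exact tendstoUniformly_normed_convolution hρ (hf.continuous_fderiv one_ne_zero) (hfc.fderiv ℝ)

section Integral

variable {α H : Type*} [MeasurableSpace α] {μ : Measure α} [NormedAddCommGroup H]
  [InnerProductSpace ℝ H]

theorem tendsto_integral_mul_of_tendsto_eLpNorm_sub {b : ℕ → α → ℝ} {b₀ : α → ℝ} {F : ℕ → α → ℝ}
    {F₀ : α → ℝ} {C : ℝ} (hb : ∀ k, AEStronglyMeasurable (b k) μ) (hbC : ∀ k x, ‖b k x‖ ≤ C)
    (hb₀ : ∀ᵐ x ∂μ, Tendsto (fun k => b k x) atTop (𝓝 (b₀ x))) (hF : ∀ k, Integrable (F k) μ)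
    (hF₀ : Integrable F₀ μ) (hFlim : Tendsto (fun k => eLpNorm (F k - F₀) 1 μ) atTop (𝓝 0)) :
    Tendsto (fun k => ∫ x, b k x * F k x ∂μ) atTop (𝓝 (∫ x, b₀ x * F₀ x ∂μ)) := by
  have hbF : ∀ k {G : α → ℝ}, Integrable G μ → Integrable (fun x => b k x * G x) μ :=
    fun k G hG => hG.bdd_mul (hb k) (Eventually.of_forall (hbC k))
  have hsub : Tendsto (fun k => ∫ x, b k x * (F k - F₀) x ∂μ) atTop (𝓝 0) := by
    rw [tendsto_zero_iff_norm_tendsto_zero]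
    have hlim : Tendsto (fun k => C * (eLpNorm (F k - F₀) 1 μ).toReal) atTop (𝓝 0) := by
      simpa using ((ENNReal.tendsto_toReal ENNReal.zero_ne_top).comp hFlim).const_mul C
    refine squeeze_zero (fun _ => norm_nonneg _) (fun k => ?_) hlim
    have hk := (hF k).sub hF₀
    calc ‖∫ x, b k x * (F k - F₀) x ∂μ‖ ≤ ∫ x, C * ‖(F k - F₀) x‖ ∂μ := by
          refine norm_integral_le_of_norm_le (hk.norm.const_mul C)
            (Eventually.of_forall fun x => ?_)
          rw [norm_mul]
          gcongr
          exact hbC k x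
      _ = C * (eLpNorm (F k - F₀) 1 μ).toReal := by
          rw [integral_const_mul, integral_norm_eq_lintegral_enorm hk.1,
            eLpNorm_one_eq_lintegral_enorm]
  have hmain : Tendsto (fun k => ∫ x, b k x * F₀ x ∂μ) atTop (𝓝 (∫ x, b₀ x * F₀ x ∂μ)) := by
    refine tendsto_integral_of_dominated_convergence (fun x => C * ‖F₀ x‖)
      (fun k => (hb k).mul hF₀.1) (hF₀.norm.const_mul C)
      (fun k => Eventually.of_forall fun x => ?_) ?_
    · rw [norm_mul]
      gcongr
      exact hbC k x
    · filter_upwards [hb₀] with x hx using hx.mul_const _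
  rw [← zero_add (∫ x, b₀ x * F₀ x ∂μ)]
  refine (hsub.add hmain).congr fun k => ?_
  rw [← integral_add (hbF k ((hF k).sub hF₀)) (hbF k hF₀)]
  simp only [← mul_add, Pi.sub_apply, sub_add_cancel]

theorem memLp_inner {s t r : ℝ≥0∞} [s.HolderTriple t r] {A V : α → H} (hA : MemLp A s μ)
    (hV : MemLp V t μ) : MemLp (fun x => (inner ℝ (A x) (V x) : ℝ)) r μ :=
  hA.of_bilin (fun a v => inner ℝ a v) 1 hV (hA.1.inner hV.1)
    (Eventually.of_forall fun x => by simpa using nnnorm_inner_le_nnnorm (𝕜 := ℝ) (A x) (V x))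

theorem integrable_inner {s t : ℝ≥0∞} [s.HolderConjugate t] {A V : α → H} (hA : MemLp A s μ)
    (hV : MemLp V t μ) : Integrable (fun x => (inner ℝ (A x) (V x) : ℝ)) μ :=
  memLp_one_iff_integrable.1 (memLp_inner hA hV)

theorem tendsto_eLpNorm_inner_sub_inner {s t r : ℝ≥0∞} [s.HolderTriple t r] {A : α → H}
    {V : ℕ → α → H} {V₀ : α → H} (hA : MemLp A s μ)
    (hV : ∀ k, AEStronglyMeasurable (V k) μ) (hV₀ : AEStronglyMeasurable V₀ μ)
    (hVlim : Tendsto (fun k => eLpNorm (V k - V₀) t μ) atTop (𝓝 0)) :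
    Tendsto (fun k => eLpNorm ((fun x => (inner ℝ (A x) (V k x) : ℝ)) -
      fun x => inner ℝ (A x) (V₀ x)) r μ) atTop (𝓝 0) := by
  have hlim : Tendsto (fun k => eLpNorm A s μ * eLpNorm (V k - V₀) t μ) atTop (𝓝 0) := by
    simpa using ENNReal.Tendsto.const_mul hVlim (Or.inr hA.2.ne)
  refine tendsto_of_tendsto_of_tendsto_of_le_of_le tendsto_const_nhds hlim
    (fun _ => zero_le) fun k => ?_
  have h := eLpNorm_le_eLpNorm_mul_eLpNorm_of_nnnorm (p := s) (q := t) (r := r) hA.1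
    ((hV k).sub hV₀) (fun a v : H => (inner ℝ a v : ℝ)) 1
    (Eventually.of_forall fun x => by simpa using nnnorm_inner_le_nnnorm (𝕜 := ℝ) (A x) _)
  simp only [ENNReal.coe_one, one_mul, Pi.sub_apply, inner_sub_right] at h
  exact h

theorem tendsto_integral_inner_of_tendstoUniformly {A : α → H} {V : ℕ → α → H} {V₀ : α → H}
    {C : ℝ} (hA : Integrable A μ) (hV : ∀ k, AEStronglyMeasurable (V k) μ)
    (hV₀ : ∀ x, ‖V₀ x‖ ≤ C) (hVlim : TendstoUniformly V V₀ atTop) :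
    Tendsto (fun k => ∫ x, inner ℝ (A x) (V k x) ∂μ) atTop (𝓝 (∫ x, inner ℝ (A x) (V₀ x) ∂μ)) := by
  refine tendsto_integral_filter_of_dominated_convergence (fun x => ‖A x‖ * (C + 1))
    (Eventually.of_forall fun k => hA.1.inner (hV k)) ?_ (hA.norm.mul_const _)
    (Eventually.of_forall fun x => tendsto_const_nhds.inner (hVlim.tendsto_at x))
  filter_upwards [Metric.tendstoUniformly_iff.1 hVlim 1 one_pos] with k hk
  refine Eventually.of_forall fun x => (norm_inner_le_norm _ _).trans ?_
  have hVk : ‖V k x‖ ≤ C + 1 :=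
    (norm_le_norm_add_norm_sub _ _).trans (add_le_add (hV₀ x) (dist_eq_norm (V₀ x) _ ▸ (hk x).le))
  gcongr

end Integral

/-- The vector field `|v|^{p-2} v`, so that `Δ_p u = div (pFlux p (∇u))`. -/
def pFlux {H : Type*} [NormedAddCommGroup H] [InnerProductSpace ℝ H] (p : ℝ) (v : H) : H :=
  ‖v‖ ^ (p - 2) • v

section PFlux

variable {H : Type*} [NormedAddCommGroup H] [InnerProductSpace ℝ H] {p : ℝ}

theorem inner_pFlux (p : ℝ) (v w : H) : inner ℝ (pFlux p v) w = ‖v‖ ^ (p - 2) * inner ℝ v w :=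
  real_inner_smul_left _ _ _

theorem norm_pFlux (hp : p ≠ 1) (v : H) : ‖pFlux p v‖ = ‖v‖ ^ (p - 1) := by
  rcases eq_or_ne v 0 with rfl | hv
  · simp [pFlux, Real.zero_rpow (sub_ne_zero.2 hp)]
  · rw [pFlux, norm_smul, Real.norm_of_nonneg (by positivity),
      ← Real.rpow_add_one (norm_ne_zero_iff.2 hv)]
    ring_nf

theorem inner_pFlux_self (hp : p ≠ 0) (v : H) : inner ℝ (pFlux p v) v = ‖v‖ ^ p := by
  rcases eq_or_ne v 0 with rfl | hv
  · simp [Real.zero_rpow hp]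
  · rw [inner_pFlux, real_inner_self_eq_norm_sq, ← Real.rpow_add_natCast (norm_ne_zero_iff.2 hv)]
    norm_num

theorem memLp_pFlux {α : Type*} [MeasurableSpace α] {μ : Measure α} {p' : ℝ}
    (hpp' : p.HolderConjugate p') {G : α → H} (hG : MemLp G (ENNReal.ofReal p) μ) :
    MemLp (fun x => pFlux p (G x)) (ENNReal.ofReal p') μ := by
  have h0 : 0 < p - 1 := hpp'.sub_one_pos
  have h := hG.norm_rpow_div (ENNReal.ofReal (p - 1))
  rw [ENNReal.toReal_ofReal h0.le, ← ENNReal.ofReal_div_of_pos h0, ← hpp'.conjugate_eq] at h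
  exact h.of_le ((hG.1.norm.aemeasurable.pow_const _).aestronglyMeasurable.smul hG.1)
    (Eventually.of_forall fun x => by
      rw [norm_pFlux hpp'.lt.ne', Real.norm_of_nonneg (by positivity)])

end PFlux

section Gradient

variable {E : Type*} [NormedAddCommGroup E] [InnerProductSpace ℝ E] [CompleteSpace E]

theorem norm_gradient_eq_norm_fderiv (f : E → ℝ) (x : E) : ‖gradient f x‖ = ‖fderiv ℝ f x‖ :=
  LinearIsometryEquiv.norm_map _ _

theorem gradient_fun_mul {f g : E → ℝ} {x : E} (hf : DifferentiableAt ℝ f x)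
    (hg : DifferentiableAt ℝ g x) :
    gradient (fun y => f y * g y) x = f x • gradient g x + g x • gradient f x := by
  simp [gradient, fderiv_fun_mul hf hg]

theorem gradient_fun_comp {h : ℝ → ℝ} {f : E → ℝ} {x : E} (hh : DifferentiableAt ℝ h (f x))
    (hf : DifferentiableAt ℝ f x) :
    gradient (fun y => h (f y)) x = deriv h (f x) • gradient f x := by
  have hhf : HasFDerivAt (fun y => h (f y)) (deriv h (f x) • fderiv ℝ f x) x :=
    hh.hasDerivAt.comp_hasFDerivAt x hf.hasFDerivAt
  simp [gradient, hhf.fderiv]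

theorem support_gradient_subset (f : E → ℝ) : Function.support (gradient f) ⊆ tsupport f :=
  fun x hx => support_fderiv_subset ℝ fun h => hx (by simp [gradient, h])

end Gradient

/-- The test functions of class `C¹`. The weak formulation only provides smooth ones, but the
argument uses products with `|φ|^p`, which is merely of class `C¹`. -/
structure IsC1TestFunction {E : Type*} [NormedAddCommGroup E] [NormedSpace ℝ E] (Ω : Set E)
    (φ : E → ℝ) : Prop where
  contDiff : ContDiff ℝ 1 φ
  hasCompactSupport : HasCompactSupport φ
  tsupport_subset : tsupport φ ⊆ Ω

theorem IsTestFunction.isC1TestFunction {n : ℕ} {Ω : Set (EuclideanSpace ℝ (Fin n))}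
    {φ : EuclideanSpace ℝ (Fin n) → ℝ} (hφ : IsTestFunction Ω φ) : IsC1TestFunction Ω φ :=
  ⟨hφ.contDiff.of_le (by simp), hφ.hasCompactSupport, hφ.tsupport_subset⟩

namespace IsC1TestFunction

variable {E : Type*} [NormedAddCommGroup E]

section NormedSpace

variable [NormedSpace ℝ E] {Ω : Set E} {φ : E → ℝ}

theorem differentiable (hφ : IsC1TestFunction Ω φ) : Differentiable ℝ φ :=
  hφ.contDiff.differentiable one_ne_zero

theorem mul_left (hφ : IsC1TestFunction Ω φ) {g : E → ℝ} (hg : ContDiff ℝ 1 g) :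
    IsC1TestFunction Ω (fun x => g x * φ x) where
  contDiff := hg.mul hφ.contDiff
  hasCompactSupport := hφ.hasCompactSupport.mul_left
  tsupport_subset := tsupport_mul_subset_right.trans hφ.tsupport_subset

theorem norm_rpow (hφ : IsC1TestFunction Ω φ) {p : ℝ} (hp : 1 < p) :
    IsC1TestFunction Ω (fun x => ‖φ x‖ ^ p) := by
  have h0 : ‖(0 : ℝ)‖ ^ p = 0 := by simp [Real.zero_rpow (by linarith : p ≠ 0)]
  exact
    { contDiff := hφ.contDiff.norm_rpow hp
      hasCompactSupport := hφ.hasCompactSupport.comp_left (g := fun y : ℝ => ‖y‖ ^ p) h0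
      tsupport_subset :=
        (tsupport_comp_subset (g := fun y : ℝ => ‖y‖ ^ p) h0 φ).trans hφ.tsupport_subset }

theorem exists_norm_le (hφ : IsC1TestFunction Ω φ) : ∃ C, ∀ x, ‖φ x‖ ≤ C :=
  hφ.hasCompactSupport.exists_bound_of_continuous hφ.contDiff.continuous

variable [MeasurableSpace E] [BorelSpace E] {μ : Measure E}

theorem memLp [IsFiniteMeasureOnCompacts μ] (hφ : IsC1TestFunction Ω φ) (s : ℝ≥0∞) : MemLp φ s μ :=
  hφ.contDiff.continuous.memLp_of_hasCompactSupport hφ.hasCompactSupport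

theorem integrable_mul (hφ : IsC1TestFunction Ω φ) {f : E → ℝ} (hf : LocallyIntegrableOn f Ω μ) :
    IntegrableOn (fun x => f x * φ x) Ω μ := by
  obtain ⟨C, hC⟩ := hφ.exists_norm_le
  have hfK : IntegrableOn f (tsupport φ) μ :=
    hf.integrableOn_compact_subset hφ.tsupport_subset hφ.hasCompactSupport
  have hK : IntegrableOn (fun x => f x * φ x) (tsupport φ) μ :=
    hfK.mul_bdd hφ.contDiff.continuous.aestronglyMeasurable (Eventually.of_forall hC)
  refine ((integrableOn_iff_integrable_of_support_subset fun x hx => ?_).1 hK).integrableOn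
  exact subset_tsupport _ (right_ne_zero_of_mul hx)

end NormedSpace

section InnerProductSpace

variable [InnerProductSpace ℝ E] [CompleteSpace E] {Ω : Set E} {φ : E → ℝ}

theorem continuous_gradient (hφ : IsC1TestFunction Ω φ) : Continuous (gradient φ) :=
  (InnerProductSpace.toDual ℝ E).symm.continuous.comp (hφ.contDiff.continuous_fderiv one_ne_zero)

theorem hasCompactSupport_gradient (hφ : IsC1TestFunction Ω φ) : HasCompactSupport (gradient φ) :=
  hφ.hasCompactSupport.mono' (support_gradient_subset φ)

theorem memLp_gradient [MeasurableSpace E] [BorelSpace E] {μ : Measure E}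
    [IsFiniteMeasureOnCompacts μ] (hφ : IsC1TestFunction Ω φ) (s : ℝ≥0∞) :
    MemLp (gradient φ) s μ :=
  hφ.continuous_gradient.memLp_of_hasCompactSupport hφ.hasCompactSupport_gradient

theorem norm_gradient_norm_rpow_le (hφ : IsC1TestFunction Ω φ) {p : ℝ} (hp : 1 < p) (x : E) :
    ‖gradient (fun y => ‖φ y‖ ^ p) x‖ ≤ p * ‖φ x‖ ^ (p - 1) * ‖gradient φ x‖ := by
  simpa only [norm_gradient_eq_norm_fderiv] using norm_fderiv_norm_rpow_le hφ.differentiable hp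

end InnerProductSpace

end IsC1TestFunction

section WeakDivergence

variable {n : ℕ} {Ω : Set (EuclideanSpace ℝ (Fin n))}

/-- `-div A = f` in the sense of distributions in `Ω`. -/
structure HasWeakNegDiv (Ω : Set (EuclideanSpace ℝ (Fin n)))
    (A : EuclideanSpace ℝ (Fin n) → EuclideanSpace ℝ (Fin n)) (f : EuclideanSpace ℝ (Fin n) → ℝ) :
    Prop where
  locallyIntegrableOn_field : LocallyIntegrableOn A Ω
  locallyIntegrableOn : LocallyIntegrableOn f Ω
  integral_eq : ∀ φ, IsTestFunction Ω φ →
    ∫ x in Ω, inner ℝ (A x) (gradient φ x) = ∫ x in Ω, f x * φ x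

variable {A : EuclideanSpace ℝ (Fin n) → EuclideanSpace ℝ (Fin n)}
  {f φ : EuclideanSpace ℝ (Fin n) → ℝ}

theorem IsC1TestFunction.exists_tendstoUniformly (hΩ : IsOpen Ω) (hφ : IsC1TestFunction Ω φ) :
    ∃ K, IsCompact K ∧ K ⊆ Ω ∧ ∃ ψ : ℕ → EuclideanSpace ℝ (Fin n) → ℝ,
      (∀ k, IsTestFunction Ω (ψ k)) ∧ (∀ k, tsupport (ψ k) ⊆ K) ∧
      TendstoUniformly ψ φ atTop ∧
      TendstoUniformly (fun k => gradient (ψ k)) (gradient φ) atTop := by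
  obtain ⟨K, hK, hKΩ, ψ, hψ, hψK, hlim, hlim'⟩ := exists_contDiff_tendstoUniformly hΩ
    hφ.contDiff hφ.hasCompactSupport hφ.tsupport_subset
  exact ⟨K, hK, hKΩ, ψ, fun k => ⟨hψ k, hK.of_isClosed_subset (isClosed_tsupport _) (hψK k),
    (hψK k).trans hKΩ⟩, hψK, hlim,
    (InnerProductSpace.toDual ℝ _).symm.isometry.uniformContinuous.comp_tendstoUniformly hlim'⟩

theorem tendsto_setIntegral_inner_of_tendstoUniformly {E H : Type*} [TopologicalSpace E]
    [T2Space E] [MeasurableSpace E] [OpensMeasurableSpace E] {μ : Measure E}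
    [NormedAddCommGroup H] [InnerProductSpace ℝ H] {U K : Set E} (hU : IsOpen U)
    (hK : IsCompact K) (hKU : K ⊆ U) {B V₀ : E → H} {V : ℕ → E → H}
    (hB : LocallyIntegrableOn B U μ) (hV : ∀ k, AEStronglyMeasurable (V k) μ)
    (hVK : ∀ k, Function.support (V k) ⊆ K) {C : ℝ} (hV₀ : ∀ x, ‖V₀ x‖ ≤ C)
    (hVlim : TendstoUniformly V V₀ atTop) :
    Tendsto (fun k => ∫ x in U, inner ℝ (B x) (V k x) ∂μ) atTop
      (𝓝 (∫ x in U, inner ℝ (B x) (V₀ x) ∂μ)) := by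
  have hVK' : ∀ k, ∀ x ∉ K, V k x = 0 := fun k x hx =>
    Function.notMem_support.1 fun h => hx (hVK k h)
  have hV₀K : ∀ x ∉ K, V₀ x = 0 := fun x hx =>
    tendsto_nhds_unique (hVlim.tendsto_at x) (by simp [hVK' _ x hx])
  have hrestrict : ∀ {W : E → H}, (∀ x ∉ K, W x = 0) →
      ∫ x in U, inner ℝ (B x) (W x) ∂μ = ∫ x in K, inner ℝ (B x) (W x) ∂μ := fun hW =>
    setIntegral_eq_of_subset_of_forall_sdiff_eq_zero hU.measurableSet hKU
      fun x hx => by simp [hW x hx.2]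
  simp only [hrestrict hV₀K, hrestrict (hVK' _)]
  exact tendsto_integral_inner_of_tendstoUniformly (hB.integrableOn_compact_subset hKU hK)
    (fun k => (hV k).restrict) hV₀ hVlim

theorem HasWeakNegDiv.integral_eq_of_isC1TestFunction (hA : HasWeakNegDiv Ω A f) (hΩ : IsOpen Ω)
    (hφ : IsC1TestFunction Ω φ) :
    ∫ x in Ω, inner ℝ (A x) (gradient φ x) = ∫ x in Ω, f x * φ x := by
  obtain ⟨K, hK, hKΩ, ψ, hψ, hψK, hlim, hlim'⟩ := hφ.exists_tendstoUniformly hΩ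
  obtain ⟨C, hC⟩ := hφ.exists_norm_le
  obtain ⟨C', hC'⟩ := hφ.hasCompactSupport_gradient.exists_bound_of_continuous
    hφ.continuous_gradient
  have hψ' := fun k => (hψ k).isC1TestFunction
  have hleft := tendsto_setIntegral_inner_of_tendstoUniformly hΩ hK hKΩ
    hA.locallyIntegrableOn_field (fun k => (hψ' k).continuous_gradient.aestronglyMeasurable)
    (fun k => (support_gradient_subset _).trans (hψK k)) hC' hlim'
  have hright := tendsto_setIntegral_inner_of_tendstoUniformly hΩ hK hKΩ
    hA.locallyIntegrableOn (fun k => (hψ k).contDiff.continuous.aestronglyMeasurable)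
    (fun k => (subset_tsupport _).trans (hψK k)) hC hlim
  have hmul : ∀ a b : ℝ, inner ℝ a b = a * b := fun a b => by simp [mul_comm]
  simp only [hmul, hA.integral_eq _ (hψ _)] at hleft hright
  exact tendsto_nhds_unique hleft hright

variable {p : ℝ} {s : ℝ≥0∞} {u : EuclideanSpace ℝ (Fin n) → ℝ}
  {G : EuclideanSpace ℝ (Fin n) → EuclideanSpace ℝ (Fin n)}

theorem MemSobolevZero.exists_approx_ae (hu : MemSobolevZero Ω p u G) (hp : 0 < p) :
    ∃ φ : ℕ → EuclideanSpace ℝ (Fin n) → ℝ, (∀ k, IsTestFunction Ω (φ k)) ∧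
      (∀ᵐ x ∂volume.restrict Ω, Tendsto (fun k => φ k x) atTop (𝓝 (u x))) ∧
      Tendsto (fun k => eLpNorm (gradient (φ k) - G) (ENNReal.ofReal p) (volume.restrict Ω)) atTop
        (𝓝 0) := by
  obtain ⟨φ, hφ, hlim, hlim'⟩ := hu.exists_approx
  obtain ⟨ns, hns, hae⟩ := (tendstoInMeasure_of_tendsto_eLpNorm (g := u) (by simpa using hp)
    (fun k => (hφ k).contDiff.continuous.aestronglyMeasurable) hu.memLp.1
    hlim).exists_seq_tendsto_ae
  exact ⟨fun k => φ (ns k), fun k => hφ _, hae, hlim'.comp hns.tendsto_atTop⟩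

theorem HasWeakNegDiv.integral_comp_mul_eq_of_isC1TestFunction {t : ℝ≥0∞}
    (hA : HasWeakNegDiv Ω A f) (hΩ : IsOpen Ω) [s.HolderConjugate t]
    (hAs : MemLp A s (volume.restrict Ω)) {g : ℝ → ℝ} (hg : ContDiff ℝ 1 g)
    {v : EuclideanSpace ℝ (Fin n) → ℝ} (hv : IsC1TestFunction Ω v) (hφ : IsC1TestFunction Ω φ) :
    ∫ x in Ω, g (v x) * (f x * φ x) = (∫ x in Ω, g (v x) * inner ℝ (A x) (gradient φ x)) +
      ∫ x in Ω, φ x * deriv g (v x) * inner ℝ (A x) (gradient v x) := by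
  have hgv : ContDiff ℝ 1 fun x => g (v x) := hg.comp hv.contDiff
  have hg'v : Continuous fun x => deriv g (v x) :=
    hg.continuous_deriv_one.comp hv.contDiff.continuous
  have hint : ∀ {c : EuclideanSpace ℝ (Fin n) → ℝ} {w : EuclideanSpace ℝ (Fin n) → ℝ},
      Continuous c → IsC1TestFunction Ω w →
      Integrable (fun x => c x * inner ℝ (A x) (gradient w x)) (volume.restrict Ω) := by
    intro c w hc hw
    have hcw : MemLp (fun x => c x • gradient w x) t (volume.restrict Ω) :=
      (hc.smul hw.continuous_gradient).memLp_of_hasCompactSupport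
        hw.hasCompactSupport_gradient.smul_left
    simpa only [inner_smul_right] using integrable_inner hAs hcw
  rw [← integral_add (hint hgv.continuous hφ) (hint (hφ.contDiff.continuous.fun_mul hg'v) hv)]
  simp only [mul_left_comm (g _)]
  rw [← hA.integral_eq_of_isC1TestFunction hΩ (hφ.mul_left hgv)]
  refine integral_congr_ae (Eventually.of_forall fun x => ?_)
  simp only [gradient_fun_mul (hgv.differentiable one_ne_zero x) (hφ.differentiable x),
    gradient_fun_comp (hg.differentiable one_ne_zero _) (hv.differentiable x),
    inner_add_right, inner_smul_right, mul_assoc]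

theorem HasWeakNegDiv.integral_comp_mul_eq (hA : HasWeakNegDiv Ω A f) (hΩ : IsOpen Ω)
    (hp : 0 < p) [s.HolderConjugate (ENNReal.ofReal p)] (hAs : MemLp A s (volume.restrict Ω))
    (hu : MemSobolevZero Ω p u G) {g : ℝ → ℝ} (hg : ContDiff ℝ 1 g) {C C' : ℝ}
    (hC : ∀ t, ‖g t‖ ≤ C) (hC' : ∀ t, ‖deriv g t‖ ≤ C') (hφ : IsC1TestFunction Ω φ) :
    ∫ x in Ω, g (u x) * (f x * φ x) = (∫ x in Ω, g (u x) * inner ℝ (A x) (gradient φ x)) +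
      ∫ x in Ω, φ x * deriv g (u x) * inner ℝ (A x) (G x) := by
  obtain ⟨v, hv, hae, hgrad⟩ := hu.exists_approx_ae hp
  obtain ⟨M, hM⟩ := hφ.exists_norm_le
  have hv' := fun k => (hv k).isC1TestFunction
  have hgv : ∀ k, AEStronglyMeasurable (fun x => g (v k x)) (volume.restrict Ω) :=
    fun k => (hg.continuous.comp (hv' k).contDiff.continuous).aestronglyMeasurable
  have hφg'v : ∀ k, AEStronglyMeasurable (fun x => φ x * deriv g (v k x)) (volume.restrict Ω) :=
    fun k => (hφ.contDiff.continuous.mul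
      (hg.continuous_deriv_one.comp (hv' k).contDiff.continuous)).aestronglyMeasurable
  have hgu : ∀ᵐ x ∂volume.restrict Ω, Tendsto (fun k => g (v k x)) atTop (𝓝 (g (u x))) :=
    hae.mono fun x hx => (hg.continuous.tendsto _).comp hx
  have hφg'u : ∀ᵐ x ∂volume.restrict Ω,
      Tendsto (fun k => φ x * deriv g (v k x)) atTop (𝓝 (φ x * deriv g (u x))) :=
    hae.mono fun x hx => ((hg.continuous_deriv_one.tendsto _).comp hx).const_mul _
  have hφg'_le : ∀ k x, ‖φ x * deriv g (v k x)‖ ≤ M * C' := fun k x =>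
    (norm_mul_le _ _).trans (mul_le_mul (hM x) (hC' _) (norm_nonneg _)
      ((norm_nonneg _).trans (hM x)))
  have hconst : ∀ {F : EuclideanSpace ℝ (Fin n) → ℝ}, Integrable F (volume.restrict Ω) →
      Tendsto (fun k => ∫ x in Ω, g (v k x) * F x) atTop (𝓝 (∫ x in Ω, g (u x) * F x)) :=
    fun hF => tendsto_integral_mul_of_tendsto_eLpNorm_sub hgv (fun k x => hC _) hgu
      (fun _ => hF) hF (by simp)
  have hleft := hconst (hφ.integrable_mul hA.locallyIntegrableOn)
  have hright := (hconst (integrable_inner hAs (hφ.memLp_gradient (ENNReal.ofReal p)))).add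
    (tendsto_integral_mul_of_tendsto_eLpNorm_sub hφg'v hφg'_le hφg'u
      (fun k => integrable_inner hAs ((hv' k).memLp_gradient (ENNReal.ofReal p)))
      (integrable_inner hAs hu.memLp_grad)
      (tendsto_eLpNorm_inner_sub_inner hAs (fun k => ((hv' k).memLp_gradient 1).1)
        hu.memLp_grad.1 hgrad))
  refine tendsto_nhds_unique hleft (hright.congr fun k => ?_)
  exact (hA.integral_comp_mul_eq_of_isC1TestFunction (t := ENNReal.ofReal p) hΩ hAs hg (hv' k)
    hφ).symm

end WeakDivergence

section SoftShift

theorem hasDerivAt_max_zero_sq (t : ℝ) :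
    HasDerivAt (fun x : ℝ => max x 0 ^ 2) (2 * max t 0) t := by
  have hne : ∀ x ≠ (0 : ℝ), HasDerivAt (fun x : ℝ => max x 0 ^ 2) (2 * max x 0) x := by
    intro x hx
    rcases hx.lt_or_gt with hx | hx
    · rw [max_eq_right hx.le, mul_zero]
      refine (hasDerivAt_const x 0).congr_of_eventuallyEq ?_
      filter_upwards [Iio_mem_nhds hx] with y hy
      simp [max_eq_right (Set.mem_Iio.1 hy).le]
    · rw [max_eq_left hx.le]
      refine (by simpa using hasDerivAt_pow 2 x :
        HasDerivAt (fun y : ℝ => y ^ 2) (2 * x) x).congr_of_eventuallyEq ?_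
      filter_upwards [Ioi_mem_nhds hx] with y hy
      rw [max_eq_left (Set.mem_Ioi.1 hy).le]
  exact hasDerivAt_of_hasDerivAt_of_ne' hne (by fun_prop) (by fun_prop) t

/-- A `C¹` function that equals `t + δ` for `0 ≤ t`, and is bounded below by `δ / 2` with slope
in `[0, 1]` everywhere. Its negative powers serve as globally bounded versions of
`(t + δ) ^ s` that a function in `W₀^{1,p}` can be composed with. -/
def softShift (δ t : ℝ) : ℝ := (max (t + δ) 0 ^ 2 - max t 0 ^ 2) / (2 * δ) + δ / 2

variable {δ s t : ℝ}

theorem softShift_of_nonneg (hδ : 0 < δ) (ht : 0 ≤ t) : softShift δ t = t + δ := by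
  rw [softShift, max_eq_left (by positivity), max_eq_left ht]
  field_simp
  ring

theorem half_le_softShift (hδ : 0 < δ) (t : ℝ) : δ / 2 ≤ softShift δ t := by
  have h : max t 0 ^ 2 ≤ max (t + δ) 0 ^ 2 := by
    gcongr
    linarith
  exact le_add_of_nonneg_left (div_nonneg (sub_nonneg.2 h) (by positivity))

theorem softShift_pos (hδ : 0 < δ) (t : ℝ) : 0 < softShift δ t :=
  (half_pos hδ).trans_le (half_le_softShift hδ t)

theorem hasDerivAt_softShift (hδ : δ ≠ 0) (t : ℝ) :
    HasDerivAt (softShift δ) ((max (t + δ) 0 - max t 0) / δ) t := by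
  refine (((((hasDerivAt_max_zero_sq (t + δ)).comp_add_const t δ).sub
    (hasDerivAt_max_zero_sq t)).div_const (2 * δ)).add_const (δ / 2)).congr_deriv ?_
  field_simp

theorem norm_deriv_softShift_le_one (hδ : 0 < δ) (t : ℝ) : ‖deriv (softShift δ) t‖ ≤ 1 := by
  have h := abs_max_sub_max_le_abs (t + δ) t 0
  rw [add_sub_cancel_left, abs_of_pos hδ] at h
  rw [(hasDerivAt_softShift hδ.ne' t).deriv, norm_div, Real.norm_eq_abs, Real.norm_of_nonneg hδ.le]
  exact div_le_one_of_le₀ h hδ.le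

theorem contDiff_softShift (hδ : δ ≠ 0) : ContDiff ℝ 1 (softShift δ) := by
  refine contDiff_one_iff_deriv.2 ⟨fun t => (hasDerivAt_softShift hδ t).differentiableAt, ?_⟩
  rw [funext fun t => (hasDerivAt_softShift hδ t).deriv]
  fun_prop

theorem contDiff_softShift_rpow (hδ : 0 < δ) (s : ℝ) : ContDiff ℝ 1 fun t => softShift δ t ^ s :=
  (contDiff_softShift hδ.ne').rpow_const_of_ne fun t => (softShift_pos hδ t).ne'

theorem deriv_softShift_rpow (hδ : 0 < δ) (s t : ℝ) :
    deriv (fun t => softShift δ t ^ s) t =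
      deriv (softShift δ) t * s * softShift δ t ^ (s - 1) :=
  ((hasDerivAt_softShift hδ.ne' t).differentiableAt.hasDerivAt.rpow_const
    (Or.inl (softShift_pos hδ t).ne')).deriv

theorem deriv_softShift_rpow_of_nonneg (hδ : 0 < δ) (s : ℝ) (ht : 0 ≤ t) :
    deriv (fun t => softShift δ t ^ s) t = s * (t + δ) ^ (s - 1) := by
  rw [deriv_softShift_rpow hδ, softShift_of_nonneg hδ ht, (hasDerivAt_softShift hδ.ne' t).deriv,
    max_eq_left (by positivity), max_eq_left ht, add_sub_cancel_left, div_self hδ.ne', one_mul]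

theorem norm_softShift_rpow_le (hδ : 0 < δ) (hs : s ≤ 0) (t : ℝ) :
    ‖softShift δ t ^ s‖ ≤ (δ / 2) ^ s := by
  rw [Real.norm_of_nonneg (Real.rpow_nonneg (softShift_pos hδ t).le s)]
  exact Real.rpow_le_rpow_of_nonpos (half_pos hδ) (half_le_softShift hδ t) hs

theorem norm_deriv_softShift_rpow_le (hδ : 0 < δ) (hs : s ≤ 1) (t : ℝ) :
    ‖deriv (fun t => softShift δ t ^ s) t‖ ≤ |s| * (δ / 2) ^ (s - 1) := by
  rw [deriv_softShift_rpow hδ, norm_mul, norm_mul, Real.norm_eq_abs s]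
  gcongr
  · exact mul_le_of_le_one_left (abs_nonneg s) (norm_deriv_softShift_le_one hδ t)
  · exact norm_softShift_rpow_le hδ (by linarith) t

end SoftShift

section Picone

theorem mul_rpow_sub_one_mul_le {p X B : ℝ} (hp : 1 < p) (hX : 0 ≤ X) (hB : 0 ≤ B) :
    p * (X ^ (p - 1) * B) ≤ (p - 1) * X ^ p + B ^ p := by
  have hp0 : 0 < p - 1 := sub_pos.2 hp
  have hpp' : (p / (p - 1)).HolderConjugate p := (Real.HolderConjugate.conjExponent hp).symm
  have young := Real.young_inequality_of_nonneg (Real.rpow_nonneg hX (p - 1)) hB hpp'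
  rw [← Real.rpow_mul hX, show (p - 1) * (p / (p - 1)) = p by field_simp] at young
  refine (mul_le_mul_of_nonneg_left young (by linarith)).trans_eq ?_
  field_simp

theorem rpow_mul_inner_pFlux_le {H : Type*} [NormedAddCommGroup H] [InnerProductSpace ℝ H]
    {p t a : ℝ} (hp : 1 < p) (ht : 0 < t) (ha : 0 ≤ a) {v w z : H}
    (hz : ‖z‖ ≤ p * a ^ (p - 1) * ‖w‖) :
    t ^ (1 - p) * inner ℝ (pFlux p v) z ≤ (p - 1) * t ^ (-p) * a ^ p * ‖v‖ ^ p + ‖w‖ ^ p :=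
  calc t ^ (1 - p) * inner ℝ (pFlux p v) z
      ≤ t ^ (1 - p) * (‖v‖ ^ (p - 1) * (p * a ^ (p - 1) * ‖w‖)) := by
        gcongr
        refine (real_inner_le_norm _ _).trans ?_
        rw [norm_pFlux hp.ne']
        gcongr
    _ = p * ((a * ‖v‖ / t) ^ (p - 1) * ‖w‖) := by
        rw [Real.div_rpow (by positivity) ht.le, Real.mul_rpow ha (norm_nonneg v), div_eq_mul_inv,
          ← Real.rpow_neg ht.le, neg_sub]
        ring
    _ ≤ (p - 1) * (a * ‖v‖ / t) ^ p + ‖w‖ ^ p :=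
        mul_rpow_sub_one_mul_le hp (by positivity) (norm_nonneg w)
    _ = (p - 1) * t ^ (-p) * a ^ p * ‖v‖ ^ p + ‖w‖ ^ p := by
        rw [Real.div_rpow (by positivity) ht.le, Real.mul_rpow ha (norm_nonneg v), div_eq_mul_inv,
          ← Real.rpow_neg ht.le]
        ring

end Picone

section NormRpow

variable {α E : Type*} [MeasurableSpace α] {ν : Measure α} [NormedAddCommGroup E] {p : ℝ}
  {V : α → E}

theorem integrable_norm_rpow (hp : 0 < p) (hV : MemLp V (ENNReal.ofReal p) ν) :
    Integrable (fun x => ‖V x‖ ^ p) ν := by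
  have h := hV.integrable_norm_rpow (by simpa using hp) ENNReal.ofReal_ne_top
  rwa [ENNReal.toReal_ofReal hp.le] at h

theorem integral_norm_rpow_eq (hp : 0 < p) (hV : MemLp V (ENNReal.ofReal p) ν) :
    ∫ x, ‖V x‖ ^ p ∂ν = (eLpNorm V (ENNReal.ofReal p) ν).toReal ^ p := by
  rw [hV.eLpNorm_eq_integral_rpow_norm (by simpa using hp) ENNReal.ofReal_ne_top,
    ENNReal.toReal_ofReal hp.le, ENNReal.toReal_ofReal (by positivity),
    ← Real.rpow_mul (by positivity), inv_mul_cancel₀ hp.ne', Real.rpow_one]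

theorem integral_norm_rpow_pos (hp : 0 < p) (hV : MemLp V (ENNReal.ofReal p) ν)
    (hV₀ : ¬ V =ᵐ[ν] 0) : 0 < ∫ x, ‖V x‖ ^ p ∂ν := by
  rw [integral_norm_rpow_eq hp hV]
  have h0 := mt (eLpNorm_eq_zero_iff hV.1 (ENNReal.ofReal_pos.2 hp).ne').1 hV₀
  exact Real.rpow_pos_of_pos (ENNReal.toReal_pos h0 hV.2.ne) p

theorem tendsto_integral_norm_rpow {W : ℕ → α → E} (hp : 1 ≤ p)
    (hV : MemLp V (ENNReal.ofReal p) ν) (hW : ∀ k, MemLp (W k) (ENNReal.ofReal p) ν)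
    (hlim : Tendsto (fun k => eLpNorm (fun x => W k x - V x) (ENNReal.ofReal p) ν) atTop (𝓝 0)) :
    Tendsto (fun k => ∫ x, ‖W k x‖ ^ p ∂ν) atTop (𝓝 (∫ x, ‖V x‖ ^ p ∂ν)) := by
  have hp0 : 0 < p := by linarith
  have : Fact (1 ≤ ENNReal.ofReal p) := ⟨by simpa using hp⟩
  have hnorm := ((Lp.tendsto_Lp_iff_tendsto_eLpNorm'' W hW V hV).2 hlim).norm
  simp only [Lp.norm_toLp] at hnorm
  simp only [integral_norm_rpow_eq hp0 hV, fun k => integral_norm_rpow_eq hp0 (hW k)]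
  exact hnorm.rpow_const (Or.inr hp0.le)

end NormRpow

section Barta

theorem tendsto_integral_div_add_rpow_mul {α : Type*} [MeasurableSpace α] {ν : Measure α}
    {u F : α → ℝ} {s : ℝ} (hs : 0 ≤ s) (hum : AEMeasurable u ν) (hu : ∀ᵐ x ∂ν, 0 < u x)
    (hF : Integrable F ν) :
    Tendsto (fun δ => ∫ x, (u x / (u x + δ)) ^ s * F x ∂ν) (𝓝[>] 0) (𝓝 (∫ x, F x ∂ν)) := by
  refine tendsto_integral_filter_of_dominated_convergence (fun x => ‖F x‖)
    (Eventually.of_forall fun δ =>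
      ((hum.div (hum.add_const δ)).pow_const s).aestronglyMeasurable.mul hF.1) ?_ hF.norm ?_
  · filter_upwards [self_mem_nhdsWithin] with δ (hδ : 0 < δ)
    filter_upwards [hu] with x hx
    rw [norm_mul, Real.norm_of_nonneg (by positivity)]
    exact mul_le_of_le_one_left (norm_nonneg _) (Real.rpow_le_one (by positivity)
      (div_le_one_of_le₀ (by linarith) (by positivity)) hs)
  · filter_upwards [hu] with x hx
    have hcont : ContinuousAt (fun δ => (u x / (u x + δ)) ^ s * F x) 0 := by
      refine ContinuousAt.mul (ContinuousAt.rpow_const ?_ (Or.inr hs)) continuousAt_const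
      exact ContinuousAt.div₀ (by fun_prop) (by fun_prop) (by simpa using hx.ne')
    simpa [div_self hx.ne'] using hcont.tendsto.mono_left nhdsWithin_le_nhds

variable {n : ℕ} {Ω : Set (EuclideanSpace ℝ (Fin n))} {p δ μ : ℝ}
  {u f φ : EuclideanSpace ℝ (Fin n) → ℝ}
  {G : EuclideanSpace ℝ (Fin n) → EuclideanSpace ℝ (Fin n)}

theorem integral_softShift_rpow_mul_le (hΩ : IsOpen Ω) (hp : 1 < p) (hδ : 0 < δ)
    (hu : MemSobolevZero Ω p u G) (hu₀ : ∀ᵐ x ∂volume.restrict Ω, 0 ≤ u x)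
    (hA : HasWeakNegDiv Ω (fun x => pFlux p (G x)) f) (hφ : IsC1TestFunction Ω φ) :
    ∫ x in Ω, softShift δ (u x) ^ (1 - p) * (f x * ‖φ x‖ ^ p) ≤
      ∫ x in Ω, ‖gradient φ x‖ ^ p := by
  have hpp' : p.HolderConjugate p.conjExponent := .conjExponent hp
  have : (ENNReal.ofReal p.conjExponent).HolderConjugate (ENNReal.ofReal p) :=
    hpp'.symm.ennrealOfReal
  have hG := memLp_pFlux hpp' hu.memLp_grad
  have hφp := hφ.norm_rpow hp
  have hg := contDiff_softShift_rpow hδ (1 - p)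
  have hC := norm_softShift_rpow_le hδ (by linarith : 1 - p ≤ 0)
  have hC' := norm_deriv_softShift_rpow_le hδ (by linarith : 1 - p ≤ 1)
  obtain ⟨M, hM⟩ := hφp.exists_norm_le
  have hint : Integrable (fun x => softShift δ (u x) ^ (1 - p) *
      inner ℝ (pFlux p (G x)) (gradient (fun y => ‖φ y‖ ^ p) x)) (volume.restrict Ω) :=
    (integrable_inner hG (hφp.memLp_gradient (ENNReal.ofReal p))).bdd_mul
      (hg.continuous.comp_aestronglyMeasurable hu.memLp.1) (Eventually.of_forall fun x => hC _)
  have hint' : Integrable (fun x => ‖φ x‖ ^ p * deriv (fun t => softShift δ t ^ (1 - p)) (u x) *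
      inner ℝ (pFlux p (G x)) (G x)) (volume.restrict Ω) :=
    (integrable_inner hG hu.memLp_grad).bdd_mul (hφp.contDiff.continuous.aestronglyMeasurable.mul
      (hg.continuous_deriv_one.comp_aestronglyMeasurable hu.memLp.1))
      (Eventually.of_forall fun x => norm_mul_le_of_le (hM x) (hC' _))
  rw [hA.integral_comp_mul_eq hΩ (by linarith) hG hu hg hC hC' hφp, ← integral_add hint hint']
  refine integral_mono_ae (hint.add hint')
    (integrable_norm_rpow (by linarith) (hφ.memLp_gradient _)) ?_
  filter_upwards [hu₀] with x hx
  have picone := rpow_mul_inner_pFlux_le hp (by positivity : 0 < u x + δ) (norm_nonneg (φ x))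
    (v := G x) (hφ.norm_gradient_norm_rpow_le hp x)
  simp only [deriv_softShift_rpow_of_nonneg hδ _ hx, softShift_of_nonneg hδ hx,
    inner_pFlux_self (by linarith : p ≠ 0), sub_sub_cancel_left]
  linarith

theorem mul_integral_div_add_rpow_mul_le (hΩ : IsOpen Ω) (hp : 1 < p) (hδ : 0 < δ)
    (hu : MemSobolevZero Ω p u G) (hu₀ : ∀ᵐ x ∂volume.restrict Ω, 0 ≤ u x)
    (hA : HasWeakNegDiv Ω (fun x => pFlux p (G x)) f)
    (hf : ∀ᵐ x ∂volume.restrict Ω, μ * u x ^ (p - 1) ≤ f x) (hφ : IsC1TestFunction Ω φ) :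
    μ * ∫ x in Ω, (u x / (u x + δ)) ^ (p - 1) * ‖φ x‖ ^ p ≤ ∫ x in Ω, ‖gradient φ x‖ ^ p := by
  refine le_trans ?_ (integral_softShift_rpow_mul_le hΩ hp hδ hu hu₀ hA hφ)
  have hφp := hφ.norm_rpow hp
  have hum : AEMeasurable u (volume.restrict Ω) := hu.memLp.1.aemeasurable
  rw [← integral_const_mul]
  refine integral_mono_ae (Integrable.const_mul ?_ μ) ?_ ?_
  · refine (memLp_one_iff_integrable.1 (hφp.memLp 1)).bdd_mul (c := 1)
      ((hum.div (hum.add_const δ)).pow_const _).aestronglyMeasurable ?_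
    filter_upwards [hu₀] with x hx
    rw [Real.norm_of_nonneg (by positivity)]
    exact Real.rpow_le_one (by positivity) (div_le_one_of_le₀ (by linarith) (by positivity))
      (by linarith)
  · exact (hφp.integrable_mul hA.locallyIntegrableOn).bdd_mul
      ((contDiff_softShift_rpow hδ (1 - p)).continuous.comp_aestronglyMeasurable hu.memLp.1)
      (Eventually.of_forall fun x => norm_softShift_rpow_le hδ (by linarith) _)
  · filter_upwards [hu₀, hf] with x hx hfx
    have hxδ : 0 < u x + δ := by positivity
    calc μ * ((u x / (u x + δ)) ^ (p - 1) * ‖φ x‖ ^ p)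
        = (u x + δ) ^ (1 - p) * (μ * u x ^ (p - 1) * ‖φ x‖ ^ p) := by
          rw [Real.div_rpow hx hxδ.le, div_eq_mul_inv, ← Real.rpow_neg hxδ.le, neg_sub]
          ring
      _ ≤ (u x + δ) ^ (1 - p) * (f x * ‖φ x‖ ^ p) := by gcongr
      _ = softShift δ (u x) ^ (1 - p) * (f x * ‖φ x‖ ^ p) := by rw [softShift_of_nonneg hδ hx]

theorem mul_integral_norm_rpow_le (hΩ : IsOpen Ω) (hp : 1 < p) (hu : MemSobolevZero Ω p u G)
    (hu₀ : ∀ᵐ x ∂volume.restrict Ω, 0 < u x) (hA : HasWeakNegDiv Ω (fun x => pFlux p (G x)) f)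
    (hf : ∀ᵐ x ∂volume.restrict Ω, μ * u x ^ (p - 1) ≤ f x) (hφ : IsC1TestFunction Ω φ) :
    μ * ∫ x in Ω, ‖φ x‖ ^ p ≤ ∫ x in Ω, ‖gradient φ x‖ ^ p := by
  have hlim := tendsto_integral_div_add_rpow_mul (sub_pos.2 hp).le hu.memLp.1.aemeasurable hu₀
    (memLp_one_iff_integrable.1 ((hφ.norm_rpow hp).memLp (μ := volume.restrict Ω) 1))
  refine le_of_tendsto (hlim.const_mul μ) ?_
  filter_upwards [self_mem_nhdsWithin] with δ (hδ : 0 < δ)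
  exact mul_integral_div_add_rpow_mul_le hΩ hp hδ hu (hu₀.mono fun x hx => hx.le) hA hf hφ

end Barta

section FirstEigenvalue

variable {n : ℕ} {Ω : Set (EuclideanSpace ℝ (Fin n))} {p μ : ℝ}

theorem firstEigenvalue_nonneg (Ω : Set (EuclideanSpace ℝ (Fin n))) (p : ℝ) :
    0 ≤ firstEigenvalue Ω p := by
  refine Real.sInf_nonneg ?_
  rintro _ ⟨u, G, -, -, rfl⟩
  positivity

theorem le_firstEigenvalue (hp : 1 ≤ p)
    (hne : ∃ u G, MemSobolevZero Ω p u G ∧ ¬ u =ᵐ[volume.restrict Ω] 0)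
    (hμ : ∀ φ, IsTestFunction Ω φ → μ * ∫ x in Ω, ‖φ x‖ ^ p ≤ ∫ x in Ω, ‖gradient φ x‖ ^ p) :
    μ ≤ firstEigenvalue Ω p := by
  obtain ⟨u₀, G₀, hu₀, hu₀ne⟩ := hne
  refine le_csInf ⟨_, u₀, G₀, hu₀, hu₀ne, rfl⟩ ?_
  rintro _ ⟨u, G, hu, hune, rfl⟩
  obtain ⟨φ, hφ, hlim, hlim'⟩ := hu.exists_approx
  have hφ' := fun k => (hφ k).isC1TestFunction
  have hle := le_of_tendsto_of_tendsto'
    ((tendsto_integral_norm_rpow hp hu.memLp (fun k => (hφ' k).memLp _) hlim).const_mul μ)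
    (tendsto_integral_norm_rpow hp hu.memLp_grad (fun k => (hφ' k).memLp_gradient _) hlim')
    fun k => hμ _ (hφ k)
  exact (le_div_iff₀ (integral_norm_rpow_pos (by linarith) hu.memLp hune)).2 hle

/-- Barta's inequality for the `p`-Laplacian. -/
theorem le_firstEigenvalue_of_supersolution {u f : EuclideanSpace ℝ (Fin n) → ℝ}
    {G : EuclideanSpace ℝ (Fin n) → EuclideanSpace ℝ (Fin n)} (hΩ : IsOpen Ω)
    (hΩne : Ω.Nonempty) (hp : 1 < p) (hu : MemSobolevZero Ω p u G)
    (hu₀ : ∀ᵐ x ∂volume.restrict Ω, 0 < u x) (hA : HasWeakNegDiv Ω (fun x => pFlux p (G x)) f)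
    (hf : ∀ᵐ x ∂volume.restrict Ω, μ * u x ^ (p - 1) ≤ f x) : μ ≤ firstEigenvalue Ω p := by
  have hΩ₀ : (ae (volume.restrict Ω)).NeBot :=
    ae_restrict_neBot.2 (hΩ.measure_pos volume hΩne).ne'
  refine le_firstEigenvalue hp.le ⟨u, G, hu, fun hzero => ?_⟩ fun φ hφ =>
    mul_integral_norm_rpow_le hΩ hp hu hu₀ hA hf hφ.isC1TestFunction
  obtain ⟨x, hx, hx0⟩ := (hu₀.and hzero).exists
  exact hx.ne' hx0

end FirstEigenvalue

section CriticalCoeff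

/-- For `0 ≤ l` and `q < p < r`, the least `Λ` such that
`l * t ^ (p - 1) ≤ Λ * t ^ (q - 1) + t ^ (r - 1)` for all `0 < t`. At `l = λ₁(p)` it is
`Λ̂(p,q,r)`. -/
def criticalCoeff (l p q r : ℝ) : ℝ :=
  l ^ ((r - q) / (r - p)) * (r - p) * ((p - q) ^ (p - q) / (r - q) ^ (r - q)) ^ (1 / (r - p))

variable {l p q r Λ : ℝ}

theorem criticalCoeff_eq (hqp : q < p) (hpr : p < r) (hl : 0 ≤ l) :
    criticalCoeff l p q r = (r - p) / (r - q) *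
      (l * ((p - q) / (r - q)) ^ ((p - q) / (r - q))) ^ ((r - p) / (r - q))⁻¹ := by
  have hrp : 0 < r - p := sub_pos.2 hpr
  have hpq : 0 < p - q := sub_pos.2 hqp
  have hrq : 0 < r - q := by linarith
  have hexp : (p - q) / (r - q) * ((r - p) / (r - q))⁻¹ = (p - q) / (r - p) := by field_simp
  have hexp' : (r - q) * (1 / (r - p)) = 1 + (p - q) / (r - p) := by field_simp; ring
  rw [criticalCoeff, Real.mul_rpow hl (by positivity), ← Real.rpow_mul (by positivity), hexp,
    inv_div, Real.div_rpow (by positivity) (by positivity), ← Real.rpow_mul hpq.le,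
    ← Real.rpow_mul hrq.le, hexp', Real.rpow_add hrq, Real.rpow_one, Real.div_rpow hpq.le hrq.le,
    mul_one_div]
  field_simp

theorem mul_rpow_le_criticalCoeff_mul_add (hqp : q < p) (hpr : p < r) (hl : 0 ≤ l) {t : ℝ}
    (ht : 0 < t) :
    l * t ^ (p - 1) ≤ criticalCoeff l p q r * t ^ (q - 1) + t ^ (r - 1) := by
  have hrp : 0 < r - p := sub_pos.2 hpr
  have hpq : 0 < p - q := sub_pos.2 hqp
  have hrq : 0 < r - q := by linarith
  rw [criticalCoeff_eq hqp hpr hl]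
  set a := (r - p) / (r - q) with ha
  set b := (p - q) / (r - q) with hb
  have ha0 : 0 < a := div_pos hrp hrq
  have hb0 : 0 < b := div_pos hpq hrq
  have hab : a + b = 1 := by rw [ha, hb, ← add_div]; field_simp; ring
  have hexp : p - 1 = (q - 1) * a + (r - 1) * b := by rw [ha, hb]; field_simp; ring
  calc l * t ^ (p - 1)
      = ((l * b ^ b) ^ a⁻¹ * t ^ (q - 1)) ^ a * (t ^ (r - 1) / b) ^ b := by
        rw [hexp, Real.rpow_add ht, Real.rpow_mul ht.le, Real.rpow_mul ht.le,
          Real.mul_rpow (by positivity) (by positivity), Real.rpow_inv_rpow (by positivity) ha0.ne',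
          Real.div_rpow (by positivity) hb0.le]
        field_simp
    _ ≤ a * ((l * b ^ b) ^ a⁻¹ * t ^ (q - 1)) + b * (t ^ (r - 1) / b) :=
        Real.geom_mean_le_arith_mean2_weighted ha0.le hb0.le (by positivity) (by positivity) hab
    _ = a * (l * b ^ b) ^ a⁻¹ * t ^ (q - 1) + t ^ (r - 1) := by
        rw [mul_div_cancel₀ _ hb0.ne', mul_assoc]

theorem exists_gt_criticalCoeff_lt (hqp : q < p) (hpr : p < r) (hΛ : criticalCoeff l p q r < Λ) :
    ∃ μ > l, criticalCoeff μ p q r < Λ := by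
  have hexp : 0 ≤ (r - q) / (r - p) := div_nonneg (by linarith) (by linarith)
  have hcont : Continuous fun l => criticalCoeff l p q r :=
    ((Real.continuous_rpow_const hexp).mul_const _).mul_const _
  exact (hcont.continuousAt.eventually_lt_const hΛ).exists_gt

theorem criticalCoeff_self (hpr : p < r) : criticalCoeff l p p r = l := by
  have hrp : 0 < r - p := sub_pos.2 hpr
  rw [criticalCoeff, div_self hrp.ne', Real.rpow_one, sub_self, Real.rpow_zero,
    Real.div_rpow zero_le_one (by positivity), Real.one_rpow, ← Real.rpow_mul hrp.le,
    mul_one_div_cancel hrp.ne', Real.rpow_one]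
  field_simp

theorem tendsto_criticalCoeff (l : ℝ) (hpr : p < r) :
    Tendsto (fun q => criticalCoeff l p q r) (𝓝[<] p) (𝓝 l) := by
  have hrp : 0 < r - p := sub_pos.2 hpr
  have hpow : ContinuousWithinAt (fun q : ℝ => (p - q) ^ (p - q)) (Set.Iio p) p := by
    have hcont : Continuous fun q : ℝ => Real.exp ((p - q) * Real.log (p - q)) :=
      Real.continuous_exp.comp (Real.continuous_mul_log.comp (by fun_prop))
    refine hcont.continuousWithinAt.congr (fun q hq => ?_) (by simp)
    rw [Real.rpow_def_of_pos (sub_pos.2 hq), mul_comm]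
  have hpow' : ContinuousAt (fun q : ℝ => (r - q) ^ (r - q)) p :=
    ContinuousAt.rpow (by fun_prop) (by fun_prop) (Or.inl hrp.ne')
  have hlpow : ContinuousAt (fun q : ℝ => l ^ ((r - q) / (r - p))) p :=
    ContinuousAt.comp' (g := fun y => l ^ y) (Real.continuousAt_const_rpow' (by simp [hrp.ne']))
      (by fun_prop)
  have hcont : ContinuousWithinAt (fun q => criticalCoeff l p q r) (Set.Iio p) p :=
    (hlpow.mul continuousAt_const).continuousWithinAt.mul
      ((hpow.div hpow'.continuousWithinAt (by positivity)).rpow_const (Or.inr (by positivity)))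
  simpa only [criticalCoeff_self hpr] using hcont.tendsto

end CriticalCoeff

section Nonexistence

variable {n : ℕ} {Ω : Set (EuclideanSpace ℝ (Fin n))} {p q r Λ : ℝ}

theorem upperThreshold_eq_criticalCoeff (Ω : Set (EuclideanSpace ℝ (Fin n))) (p q r : ℝ) :
    upperThreshold Ω p q r = criticalCoeff (firstEigenvalue Ω p) p q r :=
  rfl

theorem IsPositiveWeakSolution.exists_hasWeakNegDiv {u : EuclideanSpace ℝ (Fin n) → ℝ} (hp : 1 < p)
    (hu : IsPositiveWeakSolution Ω p q r Λ u) :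
    ∃ G, MemSobolevZero Ω p u G ∧ HasWeakNegDiv Ω (fun x => pFlux p (G x))
      (fun x => Λ * u x ^ (q - 1) + u x ^ (r - 1)) := by
  obtain ⟨-, hf, G, hG, hweak⟩ := hu
  have hpp' : p.HolderConjugate p.conjExponent := .conjExponent hp
  have hflux := memLp_pFlux hpp' hG.memLp_grad
  refine ⟨G, hG, ?_, hf, fun φ hφ => ?_⟩
  · exact locallyIntegrableOn_of_locallyIntegrable_restrict
      (hflux.locallyIntegrable (by simpa using hpp'.symm.lt.le))
  · simpa only [inner_pFlux] using hweak φ hφ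

theorem not_isPositiveWeakSolution (hΩ : IsOpen Ω) (hΩne : Ω.Nonempty) (hp : 1 < p) (hqp : q < p)
    (hpr : p < r) (hΛ : upperThreshold Ω p q r < Λ) (u : EuclideanSpace ℝ (Fin n) → ℝ) :
    ¬ IsPositiveWeakSolution Ω p q r Λ u := by
  intro hu
  rw [upperThreshold_eq_criticalCoeff] at hΛ
  obtain ⟨G, hG, hflux⟩ := hu.exists_hasWeakNegDiv hp
  obtain ⟨μ, hμ, hμΛ⟩ := exists_gt_criticalCoeff_lt hqp hpr hΛ
  have hμ0 : 0 ≤ μ := (firstEigenvalue_nonneg Ω p).trans hμ.le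
  refine hμ.not_ge (le_firstEigenvalue_of_supersolution hΩ hΩne hp hG hu.1 hflux ?_)
  filter_upwards [hu.1] with x hx
  calc μ * u x ^ (p - 1)
      ≤ criticalCoeff μ p q r * u x ^ (q - 1) + u x ^ (r - 1) :=
        mul_rpow_le_criticalCoeff_mul_add hqp hpr hμ0 hx
    _ ≤ Λ * u x ^ (q - 1) + u x ^ (r - 1) := by gcongr

theorem existenceThreshold_le (hΩ : IsOpen Ω) (hΩne : Ω.Nonempty) (hp : 1 < p) (hqp : q < p)
    (hpr : p < r) : existenceThreshold Ω p q r ≤ ENNReal.ofReal (upperThreshold Ω p q r) := by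
  refine sSup_le ?_
  rintro _ ⟨Λ, -, ⟨u, hu⟩, rfl⟩
  exact ENNReal.ofReal_le_ofReal
    (not_lt.1 fun hΛ => not_isPositiveWeakSolution hΩ hΩne hp hqp hpr hΛ u hu)

theorem limsup_existenceThreshold_le (hΩ : IsOpen Ω) (hΩne : Ω.Nonempty) (hp : 1 < p)
    (hpr : p < r) : limsup (fun q => existenceThreshold Ω p q r) (𝓝[<] p) ≤
      ENNReal.ofReal (firstEigenvalue Ω p) := by
  have hlim : Tendsto (fun q => ENNReal.ofReal (upperThreshold Ω p q r)) (𝓝[<] p)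
      (𝓝 (ENNReal.ofReal (firstEigenvalue Ω p))) :=
    ENNReal.tendsto_ofReal (tendsto_criticalCoeff _ hpr)
  rw [← hlim.limsup_eq]
  refine limsup_le_limsup ?_
  filter_upwards [self_mem_nhdsWithin] with q hqp
  exact existenceThreshold_le hΩ hΩne hp hqp hpr

end Nonexistence

end ConcaveConvex

end

theorem proposition3p1_general {n : ℕ} {Ω : Set (EuclideanSpace ℝ (Fin n))} (hΩ : IsOpen Ω)
    (hΩne : Ω.Nonempty) {p r : ℝ} (hp : 1 < p) (hpr : p < r) :
    (∀ q : ℝ, q < p →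
      (∀ Λ : ℝ, ConcaveConvex.upperThreshold Ω p q r < Λ →
        ¬ ∃ u, ConcaveConvex.IsPositiveWeakSolution Ω p q r Λ u) ∧
      ConcaveConvex.existenceThreshold Ω p q r ≤
        ENNReal.ofReal (ConcaveConvex.upperThreshold Ω p q r)) ∧
    limsup (fun q : ℝ => ConcaveConvex.existenceThreshold Ω p q r) (𝓝[<] p) ≤
      ENNReal.ofReal (ConcaveConvex.firstEigenvalue Ω p) :=
  ⟨fun _ hqp => ⟨fun _ hΛ ⟨u, hu⟩ =>
      ConcaveConvex.not_isPositiveWeakSolution hΩ hΩne hp hqp hpr hΛ u hu,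
    ConcaveConvex.existenceThreshold_le hΩ hΩne hp hqp hpr⟩,
    ConcaveConvex.limsup_existenceThreshold_le hΩ hΩne hp hpr⟩

theorem proposition3p1 (n : ℕ) (hn : 0 < n) (Ω : Set (EuclideanSpace ℝ (Fin n)))
    (hΩ_open : IsOpen Ω) (hΩ_conn : IsConnected Ω) (hΩ_bdd : Bornology.IsBounded Ω)
    (p r : ℝ) (hp : 1 < p) (hpr : p < r)
    (hr : p < (n : ℝ) → r < (n : ℝ) * p / ((n : ℝ) - p)) :
    (∀ q : ℝ, 1 < q → q < p →
      (∀ Λ : ℝ, ConcaveConvex.upperThreshold Ω p q r < Λ →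
        ¬ ∃ u, ConcaveConvex.IsPositiveWeakSolution Ω p q r Λ u) ∧
      ConcaveConvex.existenceThreshold Ω p q r ≤
        ENNReal.ofReal (ConcaveConvex.upperThreshold Ω p q r)) ∧
    limsup (fun q : ℝ => ConcaveConvex.existenceThreshold Ω p q r) (𝓝[<] p) ≤
      ENNReal.ofReal (ConcaveConvex.firstEigenvalue Ω p) :=
  have h := proposition3p1_general hΩ_open hΩ_conn.nonempty hp hpr
  ⟨fun q _ hqp => h.1 q hqp, h.2⟩
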